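/- An input consists of a number $m\ge 1$ of candidates, a number $n\ge 0$ of voters, a linear order $T_i$ on the candidates for every voter $i$ (listed from top to bottom), an attendance probability $p_i\in[0,1]$ for every voter $i$, given as a fraction of natural numbers in binary, and a distinguished candidate $c$. Every voter $i$ attends independently with probability $p_i$, so that the set $I$ of attending voters satisfies $$\Pr[I=U]=\prod_{i\in U}p_i\prod_{i\notin U}(1-p_i)\qquad\text{for every set }U\text{ of voters.}$$ Under a positional scoring rule with score vector $\vec s_m$, the score of a candidate is the sum, over the attending voters $i$, of $\vec s_m(j_i)$, where $j_i$ is the position of the candidate in $T_i$; a candidate is a winner if no candidate has a strictly larger score. The plurality rule has the score vector $(1,0,\dots,0)$ and the veto rule has the score vector $(1,\dots,1,0)$. Theorem. For the plurality rule, and likewise for the veto rule, the probability that $c$ is a winner can be computed exactly in polynomial time: there are a random access machine program and a polynomial $p$ such that on every input the program halts at logarithmic (bit) cost at most $p(L)$, where $L$ is the bit length of the input, and outputs the numerator and the nonzero denominator of a fraction of natural numbers that equals $\Pr[c\text{ is a winner}]$. -/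

import Mathlib

/-! ## Random access machines with logarithmic cost -/

namespace RAM

/-- Programs of a random access machine over the natural numbers, with finitely many named
registers (those occurring in the program) and an unbounded memory. -/
inductive Prog : Type
  /-- do nothing -/
  | skip : Prog
  /-- `r_d := k` -/
  | const (d k : ℕ) : Prog
  /-- `r_d := r_a + r_b` -/
  | add (d a b : ℕ) : Prog
  /-- `r_d := max (r_a - r_b) 0` -/
  | sub (d a b : ℕ) : Prog
  /-- `r_d := r_a * r_b` -/
  | mul (d a b : ℕ) : Prog
  /-- `r_d := mem[r_a]` -/
  | load (d a : ℕ) : Prog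
  /-- `mem[r_a] := r_b` -/
  | store (a b : ℕ) : Prog
  /-- first `P`, then `Q` -/
  | seq (P Q : Prog) : Prog
  /-- if `r_a ≠ 0` then `P` else `Q` -/
  | ite (a : ℕ) (P Q : Prog) : Prog
  /-- while `r_a ≠ 0` do `P` -/
  | loop (a : ℕ) (P : Prog) : Prog

/-- The contents of the registers and of the memory cells. -/
@[ext] structure State where
  reg : ℕ → ℕ
  mem : ℕ → ℕ

/-- Overwrite one register. -/
def State.setReg (s : State) (d v : ℕ) : State := { s with reg := Function.update s.reg d v }

/-- Overwrite one memory cell. -/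
def State.setMem (s : State) (i v : ℕ) : State := { s with mem := Function.update s.mem i v }

/-- `Exec P s s' t`: started in the state `s`, the program `P` terminates in the state `s'`, at
total logarithmic cost `t`. Every instruction and every test costs one unit plus the number of
bits (`Nat.size`) of all the numbers and memory addresses that it handles. -/
inductive Exec : Prog → State → State → ℕ → Prop
  | skip (s : State) : Exec .skip s s 1
  | const (s : State) (d k : ℕ) : Exec (.const d k) s (s.setReg d k) (1 + k.size)
  | add (s : State) (d a b : ℕ) :
      Exec (.add d a b) s (s.setReg d (s.reg a + s.reg b)) (1 + (s.reg a).size + (s.reg b).size)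
  | sub (s : State) (d a b : ℕ) :
      Exec (.sub d a b) s (s.setReg d (s.reg a - s.reg b)) (1 + (s.reg a).size + (s.reg b).size)
  | mul (s : State) (d a b : ℕ) :
      Exec (.mul d a b) s (s.setReg d (s.reg a * s.reg b)) (1 + (s.reg a).size + (s.reg b).size)
  | load (s : State) (d a : ℕ) :
      Exec (.load d a) s (s.setReg d (s.mem (s.reg a)))
        (1 + (s.reg a).size + (s.mem (s.reg a)).size)
  | store (s : State) (a b : ℕ) :
      Exec (.store a b) s (s.setMem (s.reg a) (s.reg b)) (1 + (s.reg a).size + (s.reg b).size)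
  | seq {P Q : Prog} {s s₁ s₂ : State} {t₁ t₂ : ℕ}
      (h₁ : Exec P s s₁ t₁) (h₂ : Exec Q s₁ s₂ t₂) : Exec (.seq P Q) s s₂ (t₁ + t₂)
  | ite_true {a : ℕ} {P Q : Prog} {s s₁ : State} {t : ℕ}
      (ha : s.reg a ≠ 0) (h : Exec P s s₁ t) : Exec (.ite a P Q) s s₁ (1 + (s.reg a).size + t)
  | ite_false {a : ℕ} {P Q : Prog} {s s₁ : State} {t : ℕ}
      (ha : s.reg a = 0) (h : Exec Q s s₁ t) : Exec (.ite a P Q) s s₁ (1 + (s.reg a).size + t)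
  | loop_done {a : ℕ} {P : Prog} {s : State}
      (ha : s.reg a = 0) : Exec (.loop a P) s s (1 + (s.reg a).size)
  | loop_step {a : ℕ} {P : Prog} {s s₁ s₂ : State} {t₁ t₂ : ℕ}
      (ha : s.reg a ≠ 0) (h₁ : Exec P s s₁ t₁) (h₂ : Exec (.loop a P) s₁ s₂ t₂) :
      Exec (.loop a P) s s₂ (1 + (s.reg a).size + t₁ + t₂)

/-- The machine is deterministic: the result and the cost of a run are unique. -/
theorem Exec.unique {P : Prog} {s s₁ s₂ : State} {t₁ t₂ : ℕ}
    (h₁ : Exec P s s₁ t₁) (h₂ : Exec P s s₂ t₂) : s₁ = s₂ ∧ t₁ = t₂ := by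
  induction h₁ generalizing s₂ t₂ with
  | seq _ _ ih ih' =>
    cases h₂ with
    | seq k k' =>
      obtain ⟨rfl, rfl⟩ := ih k
      obtain ⟨rfl, rfl⟩ := ih' k'
      exact ⟨rfl, rfl⟩
  | ite_true ha _ ih =>
    cases h₂ with
    | ite_true _ k => obtain ⟨rfl, rfl⟩ := ih k; exact ⟨rfl, rfl⟩
    | ite_false hb _ => exact absurd hb ha
  | ite_false ha _ ih =>
    cases h₂ with
    | ite_true hb _ => exact absurd ha hb
    | ite_false _ k => obtain ⟨rfl, rfl⟩ := ih k; exact ⟨rfl, rfl⟩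
  | loop_done ha =>
    cases h₂ with
    | loop_done _ => exact ⟨rfl, rfl⟩
    | loop_step hb _ _ => exact absurd ha hb
  | loop_step ha _ _ ih ih' =>
    cases h₂ with
    | loop_done hb => exact absurd hb ha
    | loop_step _ k k' =>
      obtain ⟨rfl, rfl⟩ := ih k
      obtain ⟨rfl, rfl⟩ := ih' k'
      exact ⟨rfl, rfl⟩
  | _ => cases h₂; exact ⟨rfl, rfl⟩

/-- The initial state: the input word occupies the first memory cells, all else is `0`. -/
def init (x : List ℕ) : State where
  reg := fun _ => 0
  mem := fun i => x.getD i 0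

/-- The length of an input word of natural numbers in bits (one extra unit per number). -/
def inputSize (x : List ℕ) : ℕ := (x.map fun k => k.size + 1).sum

/-- The function `f`, with non-negative rational values and with inputs encoded by `enc`, is
computable exactly in polynomial time: one program halts on every input, within a cost polynomial
in the bit length of the input, with the numerator and the (nonzero) denominator of a fraction
equal to the value in the registers `0` and `1`. -/
def ComputableInPolyTime {α : Type*} (enc : α → List ℕ) (f : α → ℚ) : Prop :=
  ∃ (P : Prog) (p : Polynomial ℕ), ∀ a : α, ∃ (s : State) (t : ℕ),
    Exec P (init (enc a)) s t ∧ t ≤ p.eval (inputSize (enc a)) ∧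
      s.reg 1 ≠ 0 ∧ (s.reg 0 : ℚ) / (s.reg 1 : ℚ) = f a

end RAM

/-! ## Elections with uncertain voter attendance -/

namespace Election

/-- A positional scoring rule: a non-increasing score vector for every number `m` of candidates,
whose first entry exceeds its last one (whenever there are at least two). Positions are numbered
from `0` (the top) to `m - 1` (the bottom). -/
structure ScoringRule where
  score : (m : ℕ) → Fin m → ℕ
  antitone : ∀ m, Antitone (score m)
  first_gt_last : ∀ m (hm : 2 ≤ m), score m ⟨m - 1, by omega⟩ < score m ⟨0, by omega⟩

/-- The plurality rule `(1, 0, …, 0)`. -/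
def plurality : ScoringRule where
  score _ j := if j.val = 0 then 1 else 0
  antitone m := by
    intro i j hij
    have : i.val ≤ j.val := hij
    dsimp only
    split_ifs <;> omega
  first_gt_last m hm := by
    dsimp only
    split_ifs <;> omega

/-- The veto rule `(1, …, 1, 0)`. -/
def veto : ScoringRule where
  score m j := if j.val + 1 = m then 0 else 1
  antitone m := by
    intro i j hij
    have : i.val ≤ j.val := hij
    have := j.isLt
    dsimp only
    split_ifs <;> omega
  first_gt_last m hm := by
    dsimp only
    split_ifs <;> omega

/-- An input: `m` candidates, `n` voters, the ranking of every voter (`ranking i j` is the candidate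
in position `j`), the attendance probability `num i / den i ∈ [0, 1]` of every voter, and a
distinguished candidate. -/
structure Input where
  m : ℕ
  n : ℕ
  ranking : Fin n → Equiv.Perm (Fin m)
  num : Fin n → ℕ
  den : Fin n → ℕ
  den_pos : ∀ i, 0 < den i
  num_le_den : ∀ i, num i ≤ den i
  cand : Fin m

namespace Input

variable (E : Input)

/-- The attendance probability of voter `i`. -/
def prob (i : Fin E.n) : ℚ := (E.num i : ℚ) / (E.den i : ℚ)

/-- The score of candidate `c` when exactly the voters in `U` attend. -/
def score (r : ScoringRule) (U : Finset (Fin E.n)) (c : Fin E.m) : ℕ :=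
  ∑ i ∈ U, r.score E.m ((E.ranking i).symm c)

/-- Candidate `c` is a (co-)winner when exactly the voters in `U` attend. -/
def IsWinner (r : ScoringRule) (U : Finset (Fin E.n)) (c : Fin E.m) : Prop :=
  ∀ c' : Fin E.m, E.score r U c' ≤ E.score r U c

instance (r : ScoringRule) (U : Finset (Fin E.n)) (c : Fin E.m) :
    Decidable (E.IsWinner r U c) := by
  unfold IsWinner
  infer_instance

/-- The probability that exactly the voters in `U` attend, attendances being independent. -/
def attendProb (U : Finset (Fin E.n)) : ℚ := (∏ i ∈ U, E.prob i) * ∏ i ∈ Uᶜ, (1 - E.prob i)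

/-- The probability that the distinguished candidate is a winner. -/
def winProb (r : ScoringRule) : ℚ :=
  ∑ U : Finset (Fin E.n) with E.IsWinner r U E.cand, E.attendProb U

/-- The input as a word of natural numbers: `m`, `n`, the distinguished candidate, and then, for
every voter, the numerator and denominator of the attendance probability followed by the list of
the candidates from the top to the bottom of the voter's ranking. -/
def encode : List ℕ :=
  [E.m, E.n, (E.cand : ℕ)] ++
    (List.ofFn fun i : Fin E.n =>
      [E.num i, E.den i] ++ List.ofFn fun j : Fin E.m => (E.ranking i j : ℕ)).flatten

end Input

end Election

/-! Only one candidate per ballot matters, its key: the top one under plurality, the bottom one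
under veto. Let N_x count the attending voters with key x. Then c wins iff N_x ≤ N_c for all x
(plurality) or N_c ≤ N_x for all x (veto); see `isWinner_iff`. The N_x depend on disjoint sets of
voters and are independent, so Pr[c wins] is the sum over k of Pr[N_c = k] times the product over x
≠ c of Pr[N_x ≤ k], resp. Pr[N_x ≥ k]. The law of N_x has the generating function ∏ (p_i X + 1 -
p_i) over the voters with key x. Scaling each factor by its denominator keeps everything in ℕ, and
as every voter has exactly one key, the common denominator is the product of all denominators
(`sum_powerset_prod_card`, `winProb_eq`).

The program evaluates this formula with nested counting loops, using O(m n³) instructions when n > 0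
(`wp_winProbPos`). The coefficients of a scaled generating function sum to its value at 1, at most 2
^ (L n) (`sum_coeff_votes_le`), so all numbers stay below 2 ^ O(L³). Instruction count times bit
length is then polynomial. With n = 0 the binary number m may be exponential in L, so that case is
answered directly. -/

namespace RAM

/-! ### A program logic that bounds instruction count and number size. -/

/-- All registers and memory cells hold numbers at most `V`. -/
def State.Bdd (V : ℕ) (s : State) : Prop := (∀ r, s.reg r ≤ V) ∧ ∀ i, s.mem i ≤ V

@[simp] theorem State.reg_setReg (s : State) (d v r : ℕ) :
    (s.setReg d v).reg r = if r = d then v else s.reg r := by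
  simp [State.setReg, Function.update_apply]

@[simp] theorem State.mem_setReg (s : State) (d v : ℕ) : (s.setReg d v).mem = s.mem := rfl

@[simp] theorem State.reg_setMem (s : State) (i v : ℕ) : (s.setMem i v).reg = s.reg := rfl

@[simp] theorem State.mem_setMem (s : State) (i v j : ℕ) :
    (s.setMem i v).mem j = if j = i then v else s.mem j := by
  simp [State.setMem, Function.update_apply]

theorem State.Bdd.setReg {V : ℕ} {s : State} (h : s.Bdd V) (d : ℕ) {v : ℕ} (hv : v ≤ V) :
    (s.setReg d v).Bdd V := by
  refine ⟨fun r => ?_, h.2⟩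
  rw [State.reg_setReg]
  split_ifs
  exacts [hv, h.1 r]

theorem State.Bdd.setMem {V : ℕ} {s : State} (h : s.Bdd V) (i : ℕ) {v : ℕ} (hv : v ≤ V) :
    (s.setMem i v).Bdd V := by
  refine ⟨h.1, fun j => ?_⟩
  rw [State.mem_setMem]
  split_ifs
  exacts [hv, h.2 j]

/-- Whether the program contains an instruction that writes to the register `r`. -/
def Prog.writes (r : ℕ) : Prog → Bool
  | .skip => false
  | .const d _ => r == d
  | .add d _ _ => r == d
  | .sub d _ _ => r == d
  | .mul d _ _ => r == d
  | .load d _ => r == d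
  | .store _ _ => false
  | .seq P Q => P.writes r || Q.writes r
  | .ite _ P Q => P.writes r || Q.writes r
  | .loop _ P => P.writes r

/-- The condition is syntactic and decided by `rfl`, so loop invariants need to mention only what
changes. -/
theorem Exec.reg_eq {P : Prog} {s s' : State} {t r : ℕ} (h : Exec P s s' t)
    (hr : P.writes r = false) : s'.reg r = s.reg r := by
  induction h <;> simp_all [Prog.writes]

/-- Weakest precondition with resources: from `s`, as long as its contents are at most `V`, the
program `P` runs into a state satisfying `Q` whose contents are again at most `V`, at the cost of
at most `k` instructions that handle numbers up to `V`. -/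
def WP (V k : ℕ) (P : Prog) (Q : State → Prop) (s : State) : Prop :=
  s.Bdd V → ∃ s' t, Exec P s s' t ∧ t ≤ k * (1 + 2 * V.size) ∧ s'.Bdd V ∧ Q s'

namespace WP

variable {V k k' k₁ k₂ d a b v : ℕ} {P P' : Prog} {Q Q' : State → Prop} {s : State}

theorem mono (h : WP V k P Q s) (hk : k ≤ k') (hQ : ∀ s', Q s' → Q' s') : WP V k' P Q' s := by
  intro hB
  obtain ⟨s', t, h₁, h₂, h₃, h₄⟩ := h hB
  exact ⟨s', t, h₁, h₂.trans (Nat.mul_le_mul_right _ hk), h₃, hQ _ h₄⟩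

theorem frame (h : WP V k P Q s) :
    WP V k P (fun s' => Q s' ∧ ∀ r, P.writes r = false → s'.reg r = s.reg r) s := by
  intro hB
  obtain ⟨s', t, h₁, h₂, h₃, h₄⟩ := h hB
  exact ⟨s', t, h₁, h₂, h₃, h₄, fun r hr => h₁.reg_eq hr⟩

/-- Numbers already stored are at most `V`; this makes that fact available in size estimates. -/
theorem of_bdd (h : s.Bdd V → WP V k P Q s) : WP V k P Q s := fun hB => h hB hB

theorem skip (h : Q s) : WP V 1 .skip Q s :=
  fun hB => ⟨s, 1, .skip s, by omega, hB, h⟩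

theorem const (hV : v ≤ V) (h : Q (s.setReg d v)) : WP V 1 (.const d v) Q s := by
  intro hB
  have := Nat.size_le_size hV
  exact ⟨_, _, .const s d v, by omega, hB.setReg d hV, h⟩

theorem add (hv : s.reg a + s.reg b = v) (hV : v ≤ V) (h : Q (s.setReg d v)) :
    WP V 1 (.add d a b) Q s := by
  intro hB
  subst hv
  have := Nat.size_le_size (hB.1 a)
  have := Nat.size_le_size (hB.1 b)
  exact ⟨_, _, .add s d a b, by omega, hB.setReg d hV, h⟩

theorem sub (hv : s.reg a - s.reg b = v) (h : Q (s.setReg d v)) :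
    WP V 1 (.sub d a b) Q s := by
  intro hB
  subst hv
  have := Nat.size_le_size (hB.1 a)
  have := Nat.size_le_size (hB.1 b)
  exact ⟨_, _, .sub s d a b, by omega, hB.setReg d ((Nat.sub_le _ _).trans (hB.1 a)), h⟩

theorem mul (hv : s.reg a * s.reg b = v) (hV : v ≤ V) (h : Q (s.setReg d v)) :
    WP V 1 (.mul d a b) Q s := by
  intro hB
  subst hv
  have := Nat.size_le_size (hB.1 a)
  have := Nat.size_le_size (hB.1 b)
  exact ⟨_, _, .mul s d a b, by omega, hB.setReg d hV, h⟩

theorem load (hv : s.mem (s.reg a) = v) (h : Q (s.setReg d v)) : WP V 1 (.load d a) Q s := by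
  intro hB
  subst hv
  have := Nat.size_le_size (hB.1 a)
  have := Nat.size_le_size (hB.2 (s.reg a))
  exact ⟨_, _, .load s d a, by omega, hB.setReg d (hB.2 _), h⟩

theorem store {i : ℕ} (hi : s.reg a = i) (hv : s.reg b = v) (h : Q (s.setMem i v)) :
    WP V 1 (.store a b) Q s := by
  intro hB
  subst hv hi
  have := Nat.size_le_size (hB.1 a)
  have := Nat.size_le_size (hB.1 b)
  exact ⟨_, _, .store s a b, by omega, hB.setMem _ (hB.1 b), h⟩

theorem seq (h : WP V k₁ P (WP V k₂ P' Q) s) : WP V (k₂ + k₁) (.seq P P') Q s := by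
  intro hB
  obtain ⟨s₁, t₁, e₁, ht₁, hB₁, h₁⟩ := h hB
  obtain ⟨s₂, t₂, e₂, ht₂, hB₂, h₂⟩ := h₁ hB₁
  exact ⟨s₂, _, e₁.seq e₂, by rw [add_mul]; omega, hB₂, h₂⟩

/-- Budgets of straight-line code accumulate as `… + 1 + 1`, which explains the unevaluated sums in
later statements. -/
theorem step (h : WP V 1 P (WP V k P' Q) s) : WP V (k + 1) (.seq P P') Q s := seq h

theorem ite (h₁ : s.reg a ≠ 0 → WP V k P Q s) (h₀ : s.reg a = 0 → WP V k P' Q s) :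
    WP V (k + 1) (.ite a P P') Q s := by
  intro hB
  have := Nat.size_le_size (hB.1 a)
  by_cases ha : s.reg a = 0
  · obtain ⟨s₁, t₁, e₁, ht₁, hB₁, hQ⟩ := h₀ ha hB
    exact ⟨s₁, _, .ite_false ha e₁, by rw [add_mul]; omega, hB₁, hQ⟩
  · obtain ⟨s₁, t₁, e₁, ht₁, hB₁, hQ⟩ := h₁ ha hB
    exact ⟨s₁, _, .ite_true ha e₁, by rw [add_mul]; omega, hB₁, hQ⟩

/-- The rule for a loop whose test register counts down from `n`. -/
theorem loop (n : ℕ) (I : ℕ → State → Prop) (hn : s.reg a = n) (h0 : I 0 s)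
    (hstep : ∀ i < n, ∀ s', s'.reg a = n - i → I i s' →
      (∀ r, P.writes r = false → s'.reg r = s.reg r) →
      WP V k P (fun s'' => s''.reg a = n - (i + 1) ∧ I (i + 1) s'') s')
    (hQ : ∀ s', I n s' → (∀ r, P.writes r = false → s'.reg r = s.reg r) → Q s') :
    WP V (n * (k + 1) + 1) (.loop a P) Q s := by
  -- Induction on the number `j` of remaining rounds; the invariant is indexed by the completed
  -- ones.
  have key : ∀ j ≤ n, ∀ s', s'.reg a = j → I (n - j) s' →
      (∀ r, P.writes r = false → s'.reg r = s.reg r) →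
      WP V (j * (k + 1) + 1) (.loop a P) Q s' := by
    intro j
    induction j with
    | zero =>
      intro _ s' ha hI hf hB
      refine ⟨s', _, .loop_done ha, ?_, hB, hQ _ (by simpa using hI) hf⟩
      have := Nat.size_le_size (hB.1 a)
      omega
    | succ j ih =>
      intro hj s' ha hI hf hB
      have hlt : n - (j + 1) < n := by omega
      obtain ⟨s₁, t₁, e₁, ht₁, hB₁, ⟨ha₁, hI₁⟩, hf₁⟩ :=
        (hstep _ hlt s' (by omega) hI hf).frame hB
      have hidx : n - (j + 1) + 1 = n - j := by omega
      rw [hidx] at hI₁ ha₁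
      obtain ⟨s₂, t₂, e₂, ht₂, hB₂, h₂⟩ :=
        ih (by omega) s₁ (by omega) hI₁ (fun r hr => (hf₁ r hr).trans (hf r hr)) hB₁
      refine ⟨s₂, _, .loop_step (by omega) e₁ e₂, ?_, hB₂, h₂⟩
      have := Nat.size_le_size (hB.1 a)
      have e : ((j + 1) * (k + 1) + 1) * (1 + 2 * V.size) =
        (1 + 2 * V.size) + k * (1 + 2 * V.size) + (j * (k + 1) + 1) * (1 + 2 * V.size) := by ring
      omega
  exact key n le_rfl s hn (by simpa using h0) fun _ _ => rfl

end WP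
end RAM

/-! ### Polynomials in memory: initialization and multiplication by a linear factor. -/

namespace RAM

infixr:60 " ;; " => Prog.seq

/-- The constants in the registers `2, …, 10` and the input in the memory cells below `b`. -/
structure Env (μ : ℕ → ℕ) (m n c o b : ℕ) (s : State) : Prop where
  zero : s.reg 2 = 0
  one : s.reg 3 = 1
  cands : s.reg 4 = m
  voters : s.reg 5 = n
  cand : s.reg 6 = c
  width : s.reg 7 = m + 2
  offset : s.reg 8 = o
  base : s.reg 9 = b
  len : s.reg 10 = n + 1
  base_eq : b = 3 + n * (m + 2)
  mem : ∀ i < b, s.mem i = μ i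

theorem Env.congr {μ : ℕ → ℕ} {m n c o b : ℕ} {s s' : State} (h : Env μ m n c o b s)
    (hr : ∀ r, 2 ≤ r → r ≤ 10 → s'.reg r = s.reg r) (hm : ∀ i < b, s'.mem i = s.mem i) :
    Env μ m n c o b s' where
  zero := by rw [hr 2 (by norm_num) (by norm_num), h.zero]
  one := by rw [hr 3 (by norm_num) (by norm_num), h.one]
  cands := by rw [hr 4 (by norm_num) (by norm_num), h.cands]
  voters := by rw [hr 5 (by norm_num) (by norm_num), h.voters]
  cand := by rw [hr 6 (by norm_num) (by norm_num), h.cand]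
  width := by rw [hr 7 (by norm_num) (by norm_num), h.width]
  offset := by rw [hr 8 (by norm_num) (by norm_num), h.offset]
  base := by rw [hr 9 (by norm_num) (by norm_num), h.base]
  len := by rw [hr 10 (by norm_num) (by norm_num), h.len]
  base_eq := h.base_eq
  mem i hi := by rw [hm i hi, h.mem i hi]

/-- The first `n + 1` coefficients of `p` are stored from the memory cell `b` on. -/
def Stored (n b : ℕ) (p : Polynomial ℕ) (s : State) : Prop := ∀ j ≤ n, s.mem (b + j) = p.coeff j

theorem Stored.congr {n b : ℕ} {p : Polynomial ℕ} {s s' : State} (h : Stored n b p s)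
    (hm : s'.mem = s.mem) : Stored n b p s' := fun j hj => by rw [hm, h j hj]

open Polynomial

/-- Replace the stored polynomial by `1`. -/
def storeOne : Prog :=
  .add 31 9 2 ;; .add 30 10 2 ;;
  .loop 30 (.store 31 2 ;; .add 31 31 3 ;; .sub 30 30 3) ;;
  .store 9 3

/-- Multiply the stored polynomial by `r₂₂ X + r₂₃`. -/
def mulLinear : Prog :=
  .const 32 0 ;; .add 31 9 2 ;; .add 30 10 2 ;;
  .loop 30 (.load 33 31 ;; .mul 34 33 23 ;; .mul 35 32 22 ;; .add 34 34 35 ;; .store 31 34 ;;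
    .add 32 33 2 ;; .add 31 31 3 ;; .sub 30 30 3)

section

variable {V : ℕ} {μ : ℕ → ℕ} {m n c o b : ℕ} {s : State}

theorem wp_storeOne (he : Env μ m n c o b s) (hV : b + n + 1 ≤ V) :
    WP V (1 + ((n + 1) * (3 + 1) + 1) + 1 + 1) storeOne
      (fun s' => Stored n b 1 s' ∧ ∀ i < b, s'.mem i = s.mem i) s := by
  refine .step (.add (v := b) (by simp [he.base, he.zero]) (by omega) ?_)
  refine .step (.add (v := n + 1) (by simp [he.len, he.zero]) (by omega) ?_)
  refine .seq (.loop (n + 1) (fun i s' => s'.reg 31 = b + i ∧ (∀ j < i, s'.mem (b + j) = 0) ∧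
    ∀ i < b, s'.mem i = s.mem i) (by simp) (by simp) ?_ ?_)
  · rintro i hi s' h30 ⟨h31, harr, hmem⟩ hf
    have h2 : s'.reg 2 = 0 := by rw [hf 2 rfl]; simp [he.zero]
    have h3 : s'.reg 3 = 1 := by rw [hf 3 rfl]; simp [he.one]
    refine .step (.store h31 h2 ?_)
    refine .step (.add (v := b + (i + 1)) (by simp [h31, h3, add_assoc]) (by omega) ?_)
    refine .sub (v := n + 1 - (i + 1)) (by simp [h30, h3]; omega) ⟨by simp, by simp, ?_, ?_⟩
    · intro j hj
      by_cases hji : j = i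
      · simp [hji]
      · simp [hji, harr j (by omega)]
    · intro j hj
      simp [show j ≠ b + i by omega, hmem j hj]
  · rintro s' ⟨h31, harr, hmem⟩ hf
    refine .store (i := b) (v := 1) (by rw [hf 9 rfl]; simp [he.base])
      (by rw [hf 3 rfl]; simp [he.one]) ⟨?_, ?_⟩
    · intro j hj
      rcases j with _ | j
      · simp
      · simp [harr (j + 1) (by omega), coeff_one]
    · intro j hj
      simp [show j ≠ b by omega, hmem j hj]

/-- The product is formed in place, in ascending order: register 32 saves the old coefficient of
index `j - 1`, which has just been overwritten but is needed at index `j`. -/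
theorem wp_mulLinear (he : Env μ m n c o b s) (hV : b + n + 1 ≤ V) {p : ℕ[X]} {α β : ℕ}
    (hs : Stored n b p s) (hα : s.reg 22 = α) (hβ : s.reg 23 = β)
    (hp : ∀ j ≤ n, (p * (C α * X + C β)).coeff j ≤ V) :
    WP V ((n + 1) * (8 + 1) + 1 + 1 + 1 + 1) mulLinear
      (fun s' => Stored n b (p * (C α * X + C β)) s' ∧ ∀ i < b, s'.mem i = s.mem i) s := by
  -- Writing the shifted coefficient via `X * p` covers `j = 0`, where it is the initial 0 of
  -- register 32.
  have hco : ∀ j, (p * (C α * X + C β)).coeff j = p.coeff j * β + (X * p).coeff j * α := by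
    intro j
    rw [show p * (C α * X + C β) = C β * p + C α * (X * p) by ring, coeff_add, coeff_C_mul,
      coeff_C_mul]
    ring
  refine .of_bdd fun hB => ?_
  refine .step (.const (by omega) ?_)
  refine .step (.add (v := b) (by simp [he.base, he.zero]) (by omega) ?_)
  refine .step (.add (v := n + 1) (by simp [he.len, he.zero]) (by omega) ?_)
  refine .loop (n + 1) (fun i s' => s'.reg 31 = b + i ∧ s'.reg 32 = (X * p).coeff i ∧
    (∀ j < i, s'.mem (b + j) = (p * (C α * X + C β)).coeff j) ∧
    (∀ j, i ≤ j → j ≤ n → s'.mem (b + j) = p.coeff j) ∧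
    ∀ i < b, s'.mem i = s.mem i) (by simp)
    ⟨by simp, by simp, by simp, by simpa using fun j hj => hs j hj, by simp⟩ ?_ ?_
  · rintro i hi s' h30 ⟨h31, h32, hnew, hold, hmem⟩ hf
    have h2 : s'.reg 2 = 0 := by rw [hf 2 rfl]; simp [he.zero]
    have h3 : s'.reg 3 = 1 := by rw [hf 3 rfl]; simp [he.one]
    have h22 : s'.reg 22 = α := by rw [hf 22 rfl]; simp [hα]
    have h23 : s'.reg 23 = β := by rw [hf 23 rfl]; simp [hβ]
    have hle := hp i (by omega)
    have hpi : p.coeff i ≤ V := by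
      rw [← hs i (by omega)]
      exact hB.2 _
    rw [hco] at hle
    refine .step (.load (v := p.coeff i) (by rw [h31, hold i le_rfl (by omega)]) ?_)
    refine .step (.mul (v := p.coeff i * β) (by simp [h23]) (by omega) ?_)
    refine .step (.mul (v := (X * p).coeff i * α) (by simp [h22, h32]) (by omega) ?_)
    refine .step (.add (v := (p * (C α * X + C β)).coeff i) (by rw [hco]; simp)
      (by rw [hco]; exact hle) ?_)
    refine .step (.store (i := b + i) (v := (p * (C α * X + C β)).coeff i)
      (by simp [h31]) (by simp) ?_)
    refine .step (.add (v := p.coeff i) (by simp [h2]) hpi ?_)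
    refine .step (.add (v := b + (i + 1)) (by simp [h31, h3, add_assoc]) (by omega) ?_)
    refine .sub (v := n + 1 - (i + 1)) (by simp [h30, h3]; omega)
      ⟨by simp, by simp, by simp, ?_, ?_, ?_⟩
    · intro j hj
      by_cases hji : j = i
      · subst hji
        simp
      · simp only [State.mem_setReg, State.mem_setMem]
        rw [if_neg (by omega), hnew j (by omega)]
    · intro j hj hjn
      simp only [State.mem_setReg, State.mem_setMem]
      rw [if_neg (by omega), hold j (by omega) hjn]
    · intro j hj
      simp only [State.mem_setReg, State.mem_setMem]
      rw [if_neg (by omega), hmem j hj]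
  · rintro s' ⟨-, -, hnew, -, hmem⟩ -
    exact ⟨fun j hj => hnew j (by omega), hmem⟩

end

end RAM

/-! ### Building a generating function and extracting its coefficients. -/

namespace RAM
open Polynomial

/-- The generating function of the number of attending voters with key `x` contributed by the
voter `i` (scaled by the denominator of that voter). -/
noncomputable def factor (μ : ℕ → ℕ) (m o x i : ℕ) : ℕ[X] :=
  if μ (3 + i * (m + 2) + o) = x then
    C (μ (3 + i * (m + 2))) * X + C (μ (3 + i * (m + 2) + 1) - μ (3 + i * (m + 2)))
  else 1

/-- The scaled generating function of the number of attending voters with key `x` among the first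
`i` voters. -/
noncomputable def votes (μ : ℕ → ℕ) (m o x i : ℕ) : ℕ[X] := ∏ l ∈ Finset.range i, factor μ m o x l

/-- Multiply the stored polynomial by the factors of all voters for the candidate in `r₁₆`. -/
def mulVoters : Prog :=
  .const 21 3 ;; .add 20 5 2 ;;
  .loop 20 (.load 22 21 ;; .add 24 21 3 ;; .load 23 24 ;; .sub 23 23 22 ;;
    .add 24 21 8 ;; .load 24 24 ;; .sub 25 24 16 ;; .sub 24 16 24 ;; .add 24 24 25 ;;
    .ite 24 .skip mulLinear ;; .add 21 21 7 ;; .sub 20 20 3)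

/-- Sum up in `r₁₇` the stored coefficients whose index `j` satisfies `j ≤ r₁₃` (if `v` is true)
or `r₁₃ ≤ j` (otherwise). -/
def sumStored (v : Bool) : Prog :=
  .const 17 0 ;; .add 21 9 2 ;; .const 22 0 ;; .add 20 10 2 ;;
  .loop 20 ((if v then .sub 24 22 13 else .sub 24 13 22) ;;
    .ite 24 .skip (.load 25 21 ;; .add 17 17 25) ;;
    .add 21 21 3 ;; .add 22 22 3 ;; .sub 20 20 3)

/-- If `r₁₆ = r₆`, replace `r₁₇` by the stored coefficient with index `r₁₃`. -/
def selectStored : Prog :=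
  .sub 24 16 6 ;; .sub 25 6 16 ;; .add 24 24 25 ;; .ite 24 .skip (.add 24 9 13 ;; .load 17 24)

/-- `j ≤ k` or `k ≤ j`, depending on `v`. -/
def cmp (v : Bool) (j k : ℕ) : Prop := if v then j ≤ k else k ≤ j

instance (v : Bool) (j k : ℕ) : Decidable (cmp v j k) := by
  unfold cmp
  infer_instance

section

variable {V : ℕ} {μ : ℕ → ℕ} {m n c o b x k : ℕ} {s : State}

theorem wp_mulVoters (he : Env μ m n c o b s) (hV : b + n + m + 2 ≤ V) (ho : o < m + 2)
    (hs : Stored n b 1 s) (hx : s.reg 16 = x)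
    (hp : ∀ i ≤ n, ∀ j ≤ n, (votes μ m o x i).coeff j ≤ V) :
    WP V (n * ((1 + 1 + (((n + 1) * (8 + 1) + 1 + 1 + 1 + 1) + 1) + 1 + 1 + 1 + 1 + 1 + 1 + 1 + 1
        + 1) + 1) + 1 + 1 + 1) mulVoters
      (fun s' => Stored n b (votes μ m o x n) s' ∧ ∀ i < b, s'.mem i = s.mem i) s := by
  have hb := he.base_eq
  refine .step (.const (by omega) ?_)
  refine .step (.add (v := n) (by simp [he.voters, he.zero]) (by omega) ?_)
  refine .loop n (fun i s' => s'.reg 21 = 3 + i * (m + 2) ∧ Stored n b (votes μ m o x i) s' ∧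
    ∀ i < b, s'.mem i = s.mem i) (by simp)
    ⟨by simp, by simpa [votes] using hs.congr (by simp), by simp⟩ ?_ ?_
  · rintro i hi s' h20 ⟨h21, hst, hmem⟩ hf
    have he' : Env μ m n c o b s' := he.congr (fun r h1 h2 => by
      interval_cases r <;> (rw [hf _ rfl]; simp)) hmem
    have hx' : s'.reg 16 = x := by rw [hf 16 rfl]; simp [hx]
    have hw : (i + 1) * (m + 2) ≤ n * (m + 2) := Nat.mul_le_mul_right _ hi
    rw [add_mul, one_mul] at hw
    refine .of_bdd fun hB => ?_
    have hkey : μ (3 + i * (m + 2) + o) ≤ V := by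
      rw [← he'.mem _ (by omega)]
      exact hB.2 _
    have hxV : x ≤ V := hx' ▸ hB.1 _
    have hμ₁ := he'.mem (3 + i * (m + 2) + 1) (by omega)
    have hμ₂ := he'.mem (3 + i * (m + 2) + o) (by omega)
    refine .step (.load (v := μ (3 + i * (m + 2))) (by rw [h21, he'.mem _ (by omega)]) ?_)
    refine .step (.add (v := 3 + i * (m + 2) + 1) (by simp [h21, he'.one]) (by omega) ?_)
    refine .step (.load (v := μ (3 + i * (m + 2) + 1)) (by simp [hμ₁]) ?_)
    refine .step (.sub (v := μ (3 + i * (m + 2) + 1) - μ (3 + i * (m + 2))) (by simp) ?_)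
    refine .step (.add (v := 3 + i * (m + 2) + o) (by simp [h21, he'.offset]) (by omega) ?_)
    refine .step (.load (v := μ (3 + i * (m + 2) + o)) (by simp [hμ₂]) ?_)
    refine .step (.sub (v := μ (3 + i * (m + 2) + o) - x) (by simp [hx']) ?_)
    refine .step (.sub (v := x - μ (3 + i * (m + 2) + o)) (by simp [hx']) ?_)
    -- With truncated subtraction, `(x - y) + (y - x)` vanishes iff `x = y`, and it is at most the
    -- larger of the two.
    refine .step (.add rfl (by simp; omega) ?_)
    have hv : votes μ m o x (i + 1) = votes μ m o x i * factor μ m o x i :=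
      Finset.prod_range_succ ..
    set s₁ : State := _
    change WP V _ _ _ s₁
    have hr : ∀ r < 22, s₁.reg r = s'.reg r := fun r hr => by
      simp [s₁, show r ≠ 22 by omega, show r ≠ 23 by omega, show r ≠ 24 by omega,
        show r ≠ 25 by omega]
    have h24 : s₁.reg 24 = x - μ (3 + i * (m + 2) + o) + (μ (3 + i * (m + 2) + o) - x) := by
      simp [s₁]
    have hm₁ : s₁.mem = s'.mem := by simp [s₁]
    have he₁ : Env μ m n c o b s₁ :=
      he'.congr (fun r _ h => hr r (by omega)) (fun i _ => by rw [hm₁])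
    have hst₁ := hst.congr hm₁
    -- The branch for a different key does nothing; its budget is padded to that of `mulLinear`.
    refine .seq (.ite (fun h => .mono (k := 1) (k' := (n + 1) * (8 + 1) + 1 + 1 + 1 + 1)
      (Q := fun s' => (Stored n b (votes μ m o x (i + 1)) s' ∧ ∀ i < b, s'.mem i = s₁.mem i) ∧
        ∀ r, mulLinear.writes r = false → s'.reg r = s₁.reg r) (.skip ⟨⟨?_, by simp⟩, by simp⟩)
      (by omega) ?_) fun h => (WP.frame (wp_mulLinear he₁ (by omega) hst₁ (by simp [s₁]; rfl)
        (by simp [s₁]; rfl) ?_)).mono le_rfl ?_)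
    · rwa [hv, factor, if_neg (by omega), mul_one]
    · rintro s₂ ⟨⟨hst₂, hm₂⟩, hf₂⟩
      have h21₂ : s₂.reg 21 = s'.reg 21 := by rw [hf₂ 21 rfl, hr 21 (by norm_num)]
      refine .step (.add (v := 3 + (i + 1) * (m + 2)) ?_ (by rw [add_mul]; omega) ?_)
      · rw [h21₂, hf₂ 7 rfl, hr 7 (by norm_num), h21, he'.width]
        ring
      · refine .sub (v := n - (i + 1)) ?_ ⟨by simp, by simp, hst₂.congr (by simp), ?_⟩
        · simp [hf₂ 20 rfl, hf₂ 3 rfl, hr, h20, he'.one]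
          omega
        · intro j hj
          simp [hm₂ j hj, hm₁, hmem j hj]
    · have hfac : factor μ m o x i = _ := if_pos (by omega)
      intro j hj
      rw [← hfac, ← hv]
      exact hp _ (by omega) j hj
    · have hfac : factor μ m o x i = _ := if_pos (by omega)
      rw [← hfac, ← hv]
      rintro s₂ ⟨⟨hst₂, hm₂⟩, hf₂⟩
      have h21₂ : s₂.reg 21 = s'.reg 21 := by rw [hf₂ 21 rfl, hr 21 (by norm_num)]
      refine .step (.add (v := 3 + (i + 1) * (m + 2)) ?_ (by rw [add_mul]; omega) ?_)
      · rw [h21₂, hf₂ 7 rfl, hr 7 (by norm_num), h21, he'.width]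
        ring
      · refine .sub (v := n - (i + 1)) ?_ ⟨by simp, by simp, hst₂.congr (by simp), ?_⟩
        · simp [hf₂ 20 rfl, hf₂ 3 rfl, hr, h20, he'.one]
          omega
        · intro j hj
          simp [hm₂ j hj, hm₁, hmem j hj]
  · rintro s' ⟨-, hst, hmem⟩ -
    exact ⟨hst, hmem⟩

theorem wp_sumStored (v : Bool) (he : Env μ m n c o b s) (hV : b + n + 1 ≤ V) {p : ℕ[X]}
    (hs : Stored n b p s) (hk : s.reg 13 = k) (hp : ∑ j ∈ Finset.range (n + 1), p.coeff j ≤ V) :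
    WP V ((n + 1) * ((1 + 1 + 1 + (1 + 1 + 1) + 1) + 1) + 1 + 1 + 1 + 1 + 1) (sumStored v)
      (fun s' => s'.reg 17 = ∑ j ∈ Finset.range (n + 1), (if cmp v j k then p.coeff j else 0) ∧
        s'.mem = s.mem) s := by
  have hb := he.base_eq
  refine .step (.const (by omega) ?_)
  refine .step (.add (v := b) (by simp [he.base, he.zero]) (by omega) ?_)
  refine .step (.const (by omega) ?_)
  refine .step (.add (v := n + 1) (by simp [he.len, he.zero]) (by omega) ?_)
  refine .loop (n + 1) (fun i s' => s'.reg 21 = b + i ∧ s'.reg 22 = i ∧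
    s'.reg 17 = ∑ j ∈ Finset.range i, (if cmp v j k then p.coeff j else 0) ∧ s'.mem = s.mem)
    (by simp) (by simp) ?_ ?_
  · rintro i hi s' h20 ⟨h21, h22, h17, hmem⟩ hf
    have h3 : s'.reg 3 = 1 := by rw [hf 3 (by cases v <;> rfl)]; simp [he.one]
    have h13 : s'.reg 13 = k := by rw [hf 13 (by cases v <;> rfl)]; simp [hk]
    -- Every partial sum is dominated by the full coefficient sum, so the accumulator stays below
    -- `V`.
    have hsum : ∑ j ∈ Finset.range (i + 1), (if cmp v j k then p.coeff j else 0) ≤ V := by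
      refine le_trans ?_ hp
      refine (Finset.sum_le_sum fun j _ => ?_).trans
        (Finset.sum_le_sum_of_subset (Finset.range_subset_range.2 (show i + 1 ≤ n + 1 by omega)))
      split_ifs <;> simp
    refine .seq (k₁ := 1) (k₂ := 1 + 1 + 1 + (1 + 1 + 1)) (WP.mono (k := 1) (Q := fun s₁ => (s₁.reg 24 = 0 ↔ cmp v i k) ∧ s₁.mem = s.mem ∧
      ∀ r, r ≠ 24 → s₁.reg r = s'.reg r) ?_ le_rfl ?_)
    · cases v
      · exact .sub rfl ⟨by simp [h22, h13, cmp]; omega, by simpa, by simp +contextual⟩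
      · exact .sub rfl ⟨by simp [h22, h13, cmp]; omega, by simpa, by simp +contextual⟩
    · rintro s₁ ⟨h24, hm₁, hf₁⟩
      refine .seq (k₁ := 1 + 1 + 1) (k₂ := 1 + 1 + 1) (WP.mono (k := 1 + 1 + 1) (Q := fun s₂ =>
        s₂.reg 17 = ∑ j ∈ Finset.range (i + 1), (if cmp v j k then p.coeff j else 0) ∧
        s₂.mem = s.mem ∧ ∀ r, r ≠ 24 → r ≠ 17 → r ≠ 25 → s₂.reg r = s'.reg r) ?_ le_rfl ?_)
      · refine .ite (fun h => ?_) fun h => ?_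
        · refine WP.mono (k := 1) (.skip ⟨?_, hm₁, fun r hr _ _ => hf₁ r hr⟩) (by omega) fun _ h => h
          rw [Finset.sum_range_succ, if_neg (fun hc => h (h24.2 hc)), hf₁ 17 (by norm_num), h17,
            add_zero]
        · rw [Finset.sum_range_succ, if_pos (h24.1 h)] at hsum ⊢
          refine .step (.load (v := p.coeff i) ?_ ?_)
          · rw [hf₁ 21 (by norm_num), h21, hm₁, hs i (by omega)]
          · refine .add (v := _) ?_ hsum ⟨by simp, by simpa, ?_⟩
            · simp [hf₁ 17 (by norm_num), h17]
            · intro r h₁ h₂ h₃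
              simp [h₂, h₃, hf₁ r h₁]
      · rintro s₂ ⟨h17₂, hm₂, hf₂⟩
        refine .step (.add (v := b + (i + 1)) (by simp [hf₂, h21, h3, add_assoc]) (by omega) ?_)
        refine .step (.add (v := i + 1) (by simp [hf₂, h22, h3]) (by omega) ?_)
        refine .sub (v := n + 1 - (i + 1)) (by simp [hf₂, h20, h3]; omega) (by simp [h17₂, hm₂])
  · rintro s' ⟨-, -, h17, hmem⟩ -
    exact ⟨h17, hmem⟩

/-- The coefficient sum is computed for every candidate alike; this corrects the result for `c`,
whose count is fixed to `k`. -/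
theorem wp_selectStored (he : Env μ m n c o b s) (hV : b + n + 1 ≤ V) {p : ℕ[X]}
    (hs : Stored n b p s) (hk : s.reg 13 = k) (hkn : k ≤ n) (hx : s.reg 16 = x) :
    WP V (1 + 1 + 1 + 1 + 1 + 1) selectStored
      (fun s' => s'.reg 17 = (if x = c then p.coeff k else s.reg 17) ∧ s'.mem = s.mem) s := by
  refine .of_bdd fun hB => ?_
  have hxV : x ≤ V := hx ▸ hB.1 _
  have hcV : c ≤ V := he.cand ▸ hB.1 _
  refine .step (.sub (v := x - c) (by simp [hx, he.cand]) ?_)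
  refine .step (.sub (v := c - x) (by simp [hx, he.cand]) ?_)
  refine .step (.add (v := x - c + (c - x)) (by simp) (by omega) ?_)
  refine .ite (fun h => ?_) fun h => ?_
  · refine WP.mono (k := 1) (.skip ?_) (by omega) fun _ h => h
    simp at h
    simp [show x ≠ c by omega]
  · simp at h
    rw [if_pos (by omega)]
    refine .step (.add (v := b + k) (by simp [he.base, hk]) (by omega) ?_)
    exact .load (v := p.coeff k) (by simp [hs k hkn]) (by simp)

end
end RAM

/-! ### The loops over candidates and vote counts, and the whole program. -/

namespace RAM
open Polynomial

/-- The contribution of the generating function `p` of the candidate `x` to the event that the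
distinguished candidate `c` has exactly `k` votes and wins. -/
noncomputable def share (v : Bool) (n c k x : ℕ) (p : ℕ[X]) : ℕ :=
  if x = c then p.coeff k
  else ∑ j ∈ Finset.range (n + 1), if cmp v j k then p.coeff j else 0

theorem share_le {v : Bool} {n c k x : ℕ} (hk : k ≤ n) (p : ℕ[X]) :
    share v n c k x p ≤ ∑ j ∈ Finset.range (n + 1), p.coeff j := by
  unfold share
  split_ifs
  · exact Finset.single_le_sum (f := fun j => p.coeff j) (fun _ _ => Nat.zero_le _)
      (Finset.mem_range.2 (by omega))
  · refine Finset.sum_le_sum fun j _ => ?_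
    split_ifs <;> simp

/-- Compute in `r₁₄` the product of the shares of all candidates, for `k = r₁₃`. -/
def mulCands (v : Bool) : Prog :=
  .const 14 1 ;; .const 16 0 ;; .add 15 4 2 ;;
  .loop 15 (storeOne ;; mulVoters ;; sumStored v ;; selectStored ;; .mul 14 14 17 ;;
    .add 16 16 3 ;; .sub 15 15 3)

/-- Compute in `r₀` the sum of the results of `mulCands` over all possible numbers of votes. -/
def sumVotes (v : Bool) : Prog :=
  .const 0 0 ;; .const 13 0 ;; .add 12 10 2 ;;
  .loop 12 (mulCands v ;; .add 0 0 14 ;; .add 13 13 3 ;; .sub 12 12 3)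

/-- Compute in `r₁` the product of the denominators. -/
def mulDens : Prog :=
  .const 1 1 ;; .const 21 4 ;; .add 20 5 2 ;;
  .loop 20 (.load 24 21 ;; .mul 1 1 24 ;; .add 21 21 7 ;; .sub 20 20 3)

/-- Load the constants. -/
def setup (v : Bool) : Prog :=
  .const 3 1 ;; .load 4 2 ;; .load 5 3 ;; .const 24 2 ;; .load 6 24 ;; .add 7 4 24 ;;
  (if v then .const 8 2 else .add 8 4 3) ;;
  .mul 9 5 7 ;; .const 24 3 ;; .add 9 9 24 ;; .add 10 5 3

/-- The program for the plurality rule (if `v` is true) and for the veto rule (otherwise), provided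
that there are voters. -/
def winProbPos (v : Bool) : Prog := setup v ;; mulDens ;; sumVotes v

/-- The program for the plurality rule (if `v` is true) and for the veto rule (otherwise). Without
voters, the number of candidates may be exponential in the input length, and is not inspected. -/
def winProbProg (v : Bool) : Prog :=
  .const 3 1 ;; .load 5 3 ;; .ite 5 (winProbPos v) (.const 0 1 ;; .const 1 1)

section

variable {V D : ℕ} {μ : ℕ → ℕ} {m n c o b k : ℕ} {s : State}

theorem wp_mulCands (v : Bool) (he : Env μ m n c o b s) (hV : b + n + m + 2 ≤ V)
    (ho : o < m + 2) (hk : s.reg 13 = k) (hkn : k ≤ n)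
    (hD : ∀ i ≤ n, ∀ x, ∑ j ∈ Finset.range (n + 1), (votes μ m o x i).coeff j ≤ D)
    (hD₁ : 1 ≤ D) (hDV : D ≤ V) (hDm : D ^ m ≤ V) :
    WP V (m * (60 * (n + 1) ^ 2 + 1) + 1 + 1 + 1 + 1) (mulCands v)
      (fun s' => s'.reg 14 = ∏ x ∈ Finset.range m, share v n c k x (votes μ m o x n) ∧
        ∀ i < b, s'.mem i = s.mem i) s := by
  have hb := he.base_eq
  refine .step (.const (by omega) ?_)
  refine .step (.const (by omega) ?_)
  refine .step (.add (v := m) (by simp [he.cands, he.zero]) (by omega) ?_)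
  refine .loop m (fun x s' => s'.reg 16 = x ∧
    s'.reg 14 = ∏ x' ∈ Finset.range x, share v n c k x' (votes μ m o x' n) ∧
    ∀ i < b, s'.mem i = s.mem i) (by simp) (by simp) ?_ ?_
  · rintro x hx s' h15 ⟨h16, h14, hmem⟩ hf
    have he' : Env μ m n c o b s' := he.congr (fun r h1 h2 => by
      interval_cases r <;> (rw [hf _ (by cases v <;> rfl)]; simp)) hmem
    have h13 : s'.reg 13 = k := by rw [hf 13 (by cases v <;> rfl)]; simp [hk]
    have hco : ∀ i ≤ n, ∀ j ≤ n, (votes μ m o x i).coeff j ≤ V := fun i hi j hj =>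
      (Finset.single_le_sum (f := fun j => (votes μ m o x i).coeff j) (fun _ _ => Nat.zero_le _)
        (Finset.mem_range.2 (show j < n + 1 by omega))).trans ((hD i hi x).trans hDV)
    have hprod : ∏ x' ∈ Finset.range (x + 1), share v n c k x' (votes μ m o x' n) ≤ V := by
      refine (Finset.prod_le_pow_card _ _ D fun x' _ => ?_).trans ?_
      · exact (share_le hkn _).trans (hD n le_rfl x')
      · rw [Finset.card_range]
        exact (Nat.pow_le_pow_right hD₁ hx).trans hDm
    -- The quadratic term comes from `mulLinear` inside the loop over voters; 60 is rounded up
    -- generously.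
    have budget : 1 + 1 + 1 + (1 + 1 + 1 + 1 + 1 + 1) +
        ((n + 1) * ((1 + 1 + 1 + (1 + 1 + 1) + 1) + 1) + 1 + 1 + 1 + 1 + 1) +
        (n * ((1 + 1 + (((n + 1) * (8 + 1) + 1 + 1 + 1 + 1) + 1) + 1 + 1 + 1 + 1 + 1 + 1 + 1 + 1
          + 1) + 1) + 1 + 1 + 1) +
        (1 + ((n + 1) * (3 + 1) + 1) + 1 + 1) ≤ 60 * (n + 1) ^ 2 := by nlinarith
    refine WP.mono (.seq ((wp_storeOne he' (by omega)).frame.mono le_rfl ?_)) budget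
      fun _ h => h
    rintro s₁ ⟨⟨hst₁, hm₁⟩, hf₁⟩
    have he₁ : Env μ m n c o b s₁ := he'.congr (fun r h1 h2 => hf₁ r (by
      interval_cases r <;> rfl)) hm₁
    refine .seq ((wp_mulVoters he₁ hV ho hst₁ ((hf₁ 16 rfl).trans h16) hco).frame.mono le_rfl ?_)
    rintro s₂ ⟨⟨hst₂, hm₂⟩, hf₂⟩
    have he₂ : Env μ m n c o b s₂ := he₁.congr (fun r h1 h2 => hf₂ r (by
      interval_cases r <;> rfl)) hm₂
    have h13₂ : s₂.reg 13 = k := by rw [hf₂ 13 rfl, hf₁ 13 rfl, h13]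
    refine .seq ((wp_sumStored v he₂ (by omega) hst₂ h13₂
      ((hD n le_rfl x).trans hDV)).frame.mono le_rfl ?_)
    rintro s₃ ⟨⟨h17₃, hm₃⟩, hf₃⟩
    have he₃ : Env μ m n c o b s₃ := he₂.congr (fun r h1 h2 => hf₃ r (by
      cases v <;> interval_cases r <;> rfl)) (fun i _ => by rw [hm₃])
    have h16₃ : s₃.reg 16 = x := by
      rw [hf₃ 16 (by cases v <;> rfl), hf₂ 16 rfl, hf₁ 16 rfl, h16]
    refine .seq ((wp_selectStored he₃ (by omega) (hst₂.congr hm₃)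
      ((hf₃ 13 (by cases v <;> rfl)).trans h13₂) hkn h16₃).frame.mono le_rfl ?_)
    rintro s₄ ⟨⟨h17₄, hm₄⟩, hf₄⟩
    have hreg : ∀ r, storeOne.writes r = false → mulVoters.writes r = false →
        (sumStored v).writes r = false → selectStored.writes r = false →
        s₄.reg r = s'.reg r := fun r h₁ h₂ h₃ h₄ => by
      rw [hf₄ r h₄, hf₃ r h₃, hf₂ r h₂, hf₁ r h₁]
    have h3 := (hreg 3 rfl rfl (by cases v <;> rfl) rfl).trans he'.one
    have h14₄ := (hreg 14 rfl rfl (by cases v <;> rfl) rfl).trans h14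
    have h15₄ := (hreg 15 rfl rfl (by cases v <;> rfl) rfl).trans h15
    have h16₄ := (hreg 16 rfl rfl (by cases v <;> rfl) rfl).trans h16
    rw [h17₃] at h17₄
    refine .step (.mul (v := ∏ x' ∈ Finset.range (x + 1), share v n c k x' (votes μ m o x' n))
      ?_ hprod ?_)
    · rw [Finset.prod_range_succ, h14₄, h17₄, share]
    refine .step (.add (v := x + 1) (by simp [h16₄, h3]) (by omega) ?_)
    refine .sub (v := m - (x + 1)) (by simp [h15₄, h3]; omega)
      ⟨by simp, by simp, by simp, fun i hi => ?_⟩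
    simp [hm₄, hm₃, hm₂ i hi, hm₁ i hi, hmem i hi]
  · rintro s' ⟨-, h14, hmem⟩ -
    exact ⟨h14, hmem⟩

theorem wp_sumVotes (v : Bool) (he : Env μ m n c o b s) (hV : b + n + m + 2 ≤ V)
    (ho : o < m + 2)
    (hD : ∀ i ≤ n, ∀ x, ∑ j ∈ Finset.range (n + 1), (votes μ m o x i).coeff j ≤ D)
    (hD₁ : 1 ≤ D) (hDV : D ≤ V) (hDm : (n + 1) * D ^ m ≤ V) :
    WP V ((n + 1) * (1 + 1 + 1 + (m * (60 * (n + 1) ^ 2 + 1) + 1 + 1 + 1 + 1) + 1) + 1 + 1 + 1 + 1)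
      (sumVotes v)
      (fun s' => s'.reg 0 = ∑ k ∈ Finset.range (n + 1), ∏ x ∈ Finset.range m,
        share v n c k x (votes μ m o x n)) s := by
  have hb := he.base_eq
  refine .step (.const (by omega) ?_)
  refine .step (.const (by omega) ?_)
  refine .step (.add (v := n + 1) (by simp [he.len, he.zero]) (by omega) ?_)
  refine .loop (n + 1) (fun i s' => s'.reg 13 = i ∧
    s'.reg 0 = ∑ k ∈ Finset.range i, ∏ x ∈ Finset.range m, share v n c k x (votes μ m o x n) ∧
    ∀ i < b, s'.mem i = s.mem i) (by simp) (by simp) ?_ (fun s' h _ => h.2.1)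
  rintro k hk s' h12 ⟨h13, h0, hmem⟩ hf
  have he' : Env μ m n c o b s' := he.congr (fun r h1 h2 => by
    interval_cases r <;> (rw [hf _ (by cases v <;> rfl)]; simp)) hmem
  have hsum : ∑ k' ∈ Finset.range (k + 1), ∏ x ∈ Finset.range m,
      share v n c k' x (votes μ m o x n) ≤ V := by
    refine le_trans (Finset.sum_le_card_nsmul _ _ (D ^ m) fun k' hk' => ?_) ?_
    · rw [Finset.mem_range] at hk'
      refine (Finset.prod_le_pow_card _ _ D fun x _ => ?_).trans (by rw [Finset.card_range])
      exact (share_le (by omega) _).trans (hD n le_rfl x)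
    · rw [Finset.card_range, smul_eq_mul]
      exact (Nat.mul_le_mul_right _ hk).trans hDm
  refine .seq ((wp_mulCands v he' hV ho h13 (by omega) hD hD₁ hDV
    (le_trans (Nat.le_mul_of_pos_left _ (by omega)) hDm)).frame.mono le_rfl ?_)
  rintro s₁ ⟨⟨h14, hm₁⟩, hf₁⟩
  have h3 := (hf₁ 3 (by cases v <;> rfl)).trans he'.one
  have h0₁ := (hf₁ 0 (by cases v <;> rfl)).trans h0
  have h12₁ := (hf₁ 12 (by cases v <;> rfl)).trans h12
  have h13₁ := (hf₁ 13 (by cases v <;> rfl)).trans h13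
  refine .step (.add (by rw [h0₁, h14, ← Finset.sum_range_succ]) hsum ?_)
  refine .step (.add (v := k + 1) (by simp [h13₁, h3]) (by omega) ?_)
  refine .sub (v := n + 1 - (k + 1)) (by simp [h12₁, h3]; omega)
    ⟨by simp, by simp, by simp, fun i hi => ?_⟩
  simp [hm₁ i hi, hmem i hi]

theorem wp_mulDens (he : Env μ m n c o b s) (hV : b + n + m + 2 ≤ V)
    (hd : ∀ i ≤ n, ∏ l ∈ Finset.range i, μ (3 + l * (m + 2) + 1) ≤ V) :
    WP V (n * (4 + 1) + 1 + 1 + 1 + 1) mulDens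
      (fun s' => s'.reg 1 = ∏ l ∈ Finset.range n, μ (3 + l * (m + 2) + 1) ∧ s'.mem = s.mem) s := by
  have hb := he.base_eq
  refine .step (.const (by omega) ?_)
  -- Address 4 is `3 + 0 * (m + 2) + 1`, the cell of the first denominator.
  refine .step (.const (by omega) ?_)
  refine .step (.add (v := n) (by simp [he.voters, he.zero]) (by omega) ?_)
  refine .loop n (fun i s' => s'.reg 21 = 3 + i * (m + 2) + 1 ∧
    s'.reg 1 = ∏ l ∈ Finset.range i, μ (3 + l * (m + 2) + 1) ∧ s'.mem = s.mem)
    (by simp) (by simp) ?_ (fun s' h _ => h.2)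
  rintro i hi s' h20 ⟨h21, h1, hmem⟩ hf
  have h3 : s'.reg 3 = 1 := by rw [hf 3 rfl]; simp [he.one]
  have h7 : s'.reg 7 = m + 2 := by rw [hf 7 rfl]; simp [he.width]
  have hw : (i + 1) * (m + 2) ≤ n * (m + 2) := Nat.mul_le_mul_right _ hi
  have hw' : (i + 1) * (m + 2) = i * (m + 2) + (m + 2) := by ring
  refine .step (.load (v := μ (3 + i * (m + 2) + 1))
    (by rw [h21, hmem, he.mem _ (by omega)]) ?_)
  refine .step (.mul (v := ∏ l ∈ Finset.range (i + 1), μ (3 + l * (m + 2) + 1))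
    (by simp [h1, Finset.prod_range_succ]) (hd _ hi) ?_)
  refine .step (.add (v := 3 + (i + 1) * (m + 2) + 1) (by simp [h21, h7]; omega) (by omega) ?_)
  exact .sub (v := n - (i + 1)) (by simp [h20, h3]; omega) (by simp [hmem])

/-- The offset of the key of a voter in the input. -/
def offset (v : Bool) (m : ℕ) : ℕ := if v then 2 else m + 1

/-- Register 2, still 0, serves as the address of `m`, and register 3, set to 1, as the address of
`n`. -/
theorem wp_setup (v : Bool) (hμ : s.mem = μ) (hs : s.reg 2 = 0) (hm : μ 0 = m)
    (hn : μ 1 = n) (hc : μ 2 = c) (hV : 3 + n * (m + 2) + n + m + 2 ≤ V) :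
    WP V 11 (setup v) (Env μ m n c (offset v m) (3 + n * (m + 2))) s := by
  refine .step (.const (by omega) ?_)
  refine .step (.load (v := m) (by simp [hs, hμ, hm]) ?_)
  refine .step (.load (v := n) (by simp [hμ, hn]) ?_)
  refine .step (.const (by omega) ?_)
  refine .step (.load (v := c) (by simp [hμ, hc]) ?_)
  refine .step (.add (v := m + 2) (by simp) (by omega) ?_)
  refine .step (WP.mono (k := 1) (Q := fun s₁ => s₁.reg 8 = offset v m ∧ s₁.mem = μ ∧
    s₁.reg 2 = 0 ∧ s₁.reg 3 = 1 ∧ s₁.reg 4 = m ∧ s₁.reg 5 = n ∧ s₁.reg 6 = c ∧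
    s₁.reg 7 = m + 2) ?_ le_rfl ?_)
  · cases v
    · exact .add (v := m + 1) (by simp) (by omega) (by simp [offset, hμ, hs])
    · exact .const (by omega) (by simp [offset, hμ, hs])
  rintro s₁ ⟨h8, hm₁, h2, h3, h4, h5, h6, h7⟩
  refine .step (.mul (v := n * (m + 2)) (by simp [h5, h7]) (by omega) ?_)
  refine .step (.const (by omega) ?_)
  refine .step (.add (v := 3 + n * (m + 2)) (by simp [add_comm]) (by omega) ?_)
  refine .add (v := n + 1) (by simp [h5, h3]) (by omega) ?_
  constructor <;> simp [*]

theorem wp_winProbPos (v : Bool) (hμ : s.mem = μ) (hs : s.reg 2 = 0) (hm : μ 0 = m)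
    (hn : μ 1 = n) (hc : μ 2 = c) (hV : 3 + n * (m + 2) + n + m + 2 ≤ V) (hm₀ : 0 < m)
    (hD : ∀ i ≤ n, ∀ x,
      ∑ j ∈ Finset.range (n + 1), (votes μ m (offset v m) x i).coeff j ≤ D)
    (hD₁ : 1 ≤ D) (hDV : D ≤ V) (hDm : (n + 1) * D ^ m ≤ V)
    (hd : ∀ i ≤ n, ∏ l ∈ Finset.range i, μ (3 + l * (m + 2) + 1) ≤ V) :
    WP V (100 * (m + 1) * (n + 1) ^ 3) (winProbPos v)
      (fun s' => s'.reg 0 = (∑ k ∈ Finset.range (n + 1), ∏ x ∈ Finset.range m,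
          share v n c k x (votes μ m (offset v m) x n)) ∧
        s'.reg 1 = ∏ l ∈ Finset.range n, μ (3 + l * (m + 2) + 1)) s := by
  have ho : offset v m < m + 2 := by
    unfold offset
    split_ifs <;> omega
  have budget : (n + 1) * (1 + 1 + 1 + (m * (60 * (n + 1) ^ 2 + 1) + 1 + 1 + 1 + 1) + 1) + 1 + 1 +
      1 + 1 + (n * (4 + 1) + 1 + 1 + 1 + 1) + 11 ≤ 100 * (m + 1) * (n + 1) ^ 3 := by
    have h₁ : n + 1 ≤ (n + 1) ^ 3 := Nat.le_self_pow (by norm_num) _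
    have h₂ : m * (n + 1) ≤ m * (n + 1) ^ 3 := Nat.mul_le_mul_left _ h₁
    have : (n + 1) * (1 + 1 + 1 + (m * (60 * (n + 1) ^ 2 + 1) + 1 + 1 + 1 + 1) + 1) =
      60 * (m * (n + 1) ^ 3) + m * (n + 1) + 8 * (n + 1) := by ring
    have : 100 * (m + 1) * (n + 1) ^ 3 = 100 * (m * (n + 1) ^ 3) + 100 * (n + 1) ^ 3 := by ring
    omega
  refine WP.mono (.seq ((wp_setup v hμ hs hm hn hc hV).mono le_rfl ?_)) budget fun _ h => h
  intro s₁ he₁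
  refine .seq ((wp_mulDens he₁ hV hd).frame.mono le_rfl ?_)
  rintro s₂ ⟨⟨h1, hm₂⟩, hf₂⟩
  have he₂ := he₁.congr (fun r h1 h2 => hf₂ r (by interval_cases r <;> rfl))
    (fun i _ => by rw [hm₂])
  refine (wp_sumVotes v he₂ hV ho hD hD₁ hDV hDm).frame.mono le_rfl ?_
  rintro s₃ ⟨h0, hf₃⟩
  exact ⟨h0, (hf₃ 1 (by cases v <;> rfl)).trans h1⟩

end
end RAM

/-! ### Factorization of expectations over independent voters. -/

namespace Election
open Polynomial Finset

/-- The linear functional on polynomials that maps `X ^ j` to `g j`. -/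
noncomputable def umbral (g : ℕ → ℕ) (p : ℕ[X]) : ℕ := p.sum fun j r => r * g j

theorem umbral_add (g : ℕ → ℕ) (p q : ℕ[X]) : umbral g (p + q) = umbral g p + umbral g q :=
  Polynomial.sum_add_index p q _ (by simp) fun _ _ _ => add_mul _ _ _

theorem umbral_monomial (g : ℕ → ℕ) (j r : ℕ) : umbral g (monomial j r) = r * g j :=
  Polynomial.sum_monomial_index r _ (by simp)

/-- One more voter: absent with weight `b` the count stays, attending with weight `a` it grows by
one. -/
theorem umbral_mul_linear (g : ℕ → ℕ) (p : ℕ[X]) (a b : ℕ) :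
    umbral g (p * (C a * X + C b)) = b * umbral g p + a * umbral (fun j => g (j + 1)) p := by
  induction p using Polynomial.induction_on' with
  | add p q hp hq =>
    rw [add_mul, umbral_add, umbral_add, umbral_add, hp, hq]
    ring
  | monomial j r =>
    rw [mul_add, C_mul_X_eq_monomial, ← monomial_zero_left, monomial_mul_monomial,
      monomial_mul_monomial, umbral_add]
    simp only [umbral_monomial, add_zero]
    ring

theorem umbral_eq_sum_range (g : ℕ → ℕ) {p : ℕ[X]} {n : ℕ} (hp : p.natDegree < n) :
    umbral g p = ∑ j ∈ range n, p.coeff j * g j :=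
  Polynomial.sum_over_range' p (by simp) n hp

/-- The factorization of an expectation over independent voters into contributions of the keys. -/
theorem sum_powerset_prod_card {ι κ : Type*} [DecidableEq ι] [DecidableEq κ] [Fintype κ]
    (a b : ι → ℕ) (key : ι → κ) (S : Finset ι) (g : κ → ℕ → ℕ) :
    ∑ U ∈ S.powerset, ((∏ i ∈ U, a i) * ∏ i ∈ S \ U, b i) * ∏ x, g x #{i ∈ U | key i = x} =
      ∏ x, umbral (g x) (∏ i ∈ S, if key i = x then C (a i) * X + C (b i) else 1) := by
  -- An attending voter shifts the argument of `g` at its own key, so `g` must vary in the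
  -- induction.
  induction S using Finset.induction_on generalizing g with
  | empty => simp [← monomial_zero_one, umbral_monomial, -monomial_zero_left]
  | insert i S hi ih =>
    have h₀ : ∀ U ∈ S.powerset,
        ((∏ l ∈ U, a l) * ∏ l ∈ insert i S \ U, b l) * ∏ x, g x #{l ∈ U | key l = x} =
        b i * (((∏ l ∈ U, a l) * ∏ l ∈ S \ U, b l) * ∏ x, g x #{l ∈ U | key l = x}) := by
      intro U hU
      have hiU : i ∉ U := fun h => hi (mem_powerset.1 hU h)
      rw [insert_sdiff_of_notMem _ hiU, prod_insert (by simp [hi])]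
      ring
    have h₁ : ∀ U ∈ S.powerset,
        ((∏ l ∈ insert i U, a l) * ∏ l ∈ insert i S \ insert i U, b l) *
          ∏ x, g x #{l ∈ insert i U | key l = x} =
        a i * (((∏ l ∈ U, a l) * ∏ l ∈ S \ U, b l) *
          ∏ x, (fun j => g x (j + if key i = x then 1 else 0)) #{l ∈ U | key l = x}) := by
      intro U hU
      have hiU : i ∉ U := fun h => hi (mem_powerset.1 hU h)
      have hd : insert i S \ insert i U = S \ U := by
        ext l
        by_cases hl : l = i
        · subst hl
          simp [hi]
        · simp [hl]
      have hc : ∀ x, #{l ∈ insert i U | key l = x} =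
          #{l ∈ U | key l = x} + if key i = x then 1 else 0 := by
        intro x
        rw [filter_insert]
        split_ifs
        · rw [card_insert_of_notMem (by simp [hiU])]
        · simp
      rw [prod_insert hiU, hd]
      simp only [hc]
      ring
    rw [sum_powerset_insert hi, sum_congr rfl h₀, sum_congr rfl h₁, ← mul_sum, ← mul_sum, ih,
      ih fun x j => g x (j + if key i = x then 1 else 0)]
    simp only [prod_insert hi]
    -- Only the factor of `key i` sees the new voter; all other factors agree in the three products.
    rw [← mul_prod_erase univ _ (mem_univ (key i)), ← mul_prod_erase univ _ (mem_univ (key i)),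
      ← mul_prod_erase univ _ (mem_univ (key i))]
    have e : ∀ x ∈ univ.erase (key i),
        umbral (g x) ((if key i = x then C (a i) * X + C (b i) else 1) *
          ∏ l ∈ S, if key l = x then C (a l) * X + C (b l) else 1) =
        umbral (g x) (∏ l ∈ S, if key l = x then C (a l) * X + C (b l) else 1) := by
      intro x hx
      rw [if_neg (ne_of_mem_erase hx).symm, one_mul]
    have e' : ∀ x ∈ univ.erase (key i),
        umbral (fun j => g x (j + if key i = x then 1 else 0))
          (∏ l ∈ S, if key l = x then C (a l) * X + C (b l) else 1) =
        umbral (g x) (∏ l ∈ S, if key l = x then C (a l) * X + C (b l) else 1) := by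
      intro x hx
      simp [(ne_of_mem_erase hx).symm]
    rw [prod_congr rfl e, prod_congr rfl e']
    simp only [if_true]
    rw [mul_comm (C (a i) * X + C (b i)), umbral_mul_linear]
    ring

theorem share_eq_umbral {v : Bool} {n c k x : ℕ} (hk : k ≤ n) {p : ℕ[X]} (hp : p.natDegree ≤ n) :
    RAM.share v n c k x p =
      umbral (fun j => if (if x = c then j = k else RAM.cmp v j k) then 1 else 0) p := by
  rw [umbral_eq_sum_range _ (Nat.lt_succ_of_le hp), RAM.share]
  split_ifs with h
  · simp only [mul_ite, mul_one, mul_zero]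
    rw [sum_ite_eq' (range n.succ) k, if_pos (mem_range.2 (by omega))]
  · simp

/-! ### The winning probability as a sum of products. -/

namespace Input

variable (E : Input)

/-- The scoring rule that belongs to the value of the flag. -/
def rule (v : Bool) : ScoringRule := if v then plurality else veto

/-- The candidate in the top position (plurality) or in the bottom position (veto). -/
def key (v : Bool) (i : Fin E.n) : Fin E.m :=
  E.ranking i (if v then ⟨0, E.cand.pos⟩ else ⟨E.m - 1, Nat.sub_lt E.cand.pos one_pos⟩)

theorem isWinner_iff (v : Bool) (U : Finset (Fin E.n)) :
    E.IsWinner (rule v) U E.cand ↔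
      ∀ x, RAM.cmp v #{i ∈ U | E.key v i = x} #{i ∈ U | E.key v i = E.cand} := by
  cases v
  -- Under veto a score is the turnout minus the vetoes received, which reverses the comparison of
  -- counts.
  · have h : ∀ x, E.score veto U x + #{i ∈ U | E.key false i = x} = #U := by
      intro x
      rw [score, card_filter, ← sum_add_distrib, card_eq_sum_ones]
      refine sum_congr rfl fun i _ => ?_
      have : ((E.ranking i).symm x).val + 1 = E.m ↔ E.key false i = x := by
        rw [key, ← Equiv.eq_symm_apply, Fin.ext_iff]
        have := E.cand.pos
        simp
        omega
      simp only [veto, this]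
      split_ifs <;> rfl
    refine forall_congr' fun x => ?_
    have h₁ := h x
    have h₂ := h E.cand
    simp only [rule, RAM.cmp]
    simp
    omega
  · have h : ∀ x, E.score plurality U x = #{i ∈ U | E.key true i = x} := by
      intro x
      rw [score, card_filter]
      refine sum_congr rfl fun i _ => ?_
      have : ((E.ranking i).symm x).val = 0 ↔ E.key true i = x := by
        rw [key, ← Equiv.eq_symm_apply, Fin.ext_iff]
        simp [eq_comm]
      simp only [plurality, this]
    refine forall_congr' fun x => ?_
    simp [rule, RAM.cmp, h]

/-- The scaled generating function of the number of attending voters with key `x`. -/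
noncomputable def votes (v : Bool) (x : Fin E.m) : ℕ[X] :=
  ∏ i, if E.key v i = x then C (E.num i) * X + C (E.den i - E.num i) else 1

theorem natDegree_votes_le (v : Bool) (x : Fin E.m) : (E.votes v x).natDegree ≤ E.n := by
  refine (natDegree_prod_le _ _).trans ((sum_le_card_nsmul _ _ 1 fun i _ => ?_).trans (by simp))
  split_ifs
  · exact natDegree_linear_le
  · simp

theorem attendProb_eq (U : Finset (Fin E.n)) :
    E.attendProb U = (((∏ i ∈ U, E.num i) * ∏ i ∈ univ \ U, (E.den i - E.num i) : ℕ) : ℚ) /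
      ((∏ i, E.den i : ℕ) : ℚ) := by
  have h : ∀ i, 1 - E.prob i = ((E.den i - E.num i : ℕ) : ℚ) / (E.den i : ℚ) := by
    intro i
    have : (E.den i : ℚ) ≠ 0 := by exact_mod_cast (E.den_pos i).ne'
    rw [Nat.cast_sub (E.num_le_den i), sub_div, div_self this, prob]
  simp only [attendProb, h]
  simp only [prob, prod_div_distrib]
  rw [div_mul_div_comm, ← compl_eq_univ_sdiff, ← Nat.cast_prod, ← Nat.cast_prod, ← Nat.cast_prod,
    ← Nat.cast_prod, ← Nat.cast_mul, ← Nat.cast_mul, prod_mul_prod_compl]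

/-- The winning event is split by the number `k` of attending voters with key `c`. -/
theorem winProb_eq (v : Bool) :
    E.winProb (rule v) =
      ((∑ k ∈ range (E.n + 1), ∏ x : Fin E.m, RAM.share v E.n E.cand k x (E.votes v x) : ℕ) : ℚ) /
        ((∏ i, E.den i : ℕ) : ℚ) := by
  have key : ∀ k ∈ range (E.n + 1),
      ∏ x : Fin E.m, RAM.share v E.n E.cand k x (E.votes v x) =
      ∑ U : Finset (Fin E.n), ((∏ i ∈ U, E.num i) * ∏ i ∈ univ \ U, (E.den i - E.num i)) *
        if k = #{i ∈ U | E.key v i = E.cand} ∧ E.IsWinner (rule v) U E.cand then 1 else 0 := by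
    intro k hk
    rw [mem_range, Nat.lt_succ_iff] at hk
    rw [prod_congr rfl fun x _ => share_eq_umbral hk (E.natDegree_votes_le v x)]
    simp only [votes]
    rw [← sum_powerset_prod_card E.num (fun i => E.den i - E.num i) (E.key v) univ
      (fun x j => if (if (x : ℕ) = E.cand then j = k else RAM.cmp v j k) then 1 else 0),
      powerset_univ]
    refine sum_congr rfl fun U _ => ?_
    -- A product of indicators is the indicator of the conjunction; its conjunct at `c` forces the
    -- count to be `k`.
    rw [prod_ite_zero]
    simp only [prod_const_one, mem_univ, true_imp_iff]
    congr 2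
    rw [eq_iff_iff, isWinner_iff]
    constructor
    · intro h
      have hc := h E.cand
      rw [if_pos rfl] at hc
      refine ⟨hc.symm, fun x => ?_⟩
      have hx := h x
      rw [hc]
      split_ifs at hx with hxc
      · rw [hx]
        unfold RAM.cmp
        split_ifs <;> rfl
      · exact hx
    · rintro ⟨rfl, h⟩ x
      split_ifs with hxc
      · rw [Fin.ext hxc]
      · exact h x
  rw [sum_congr rfl key, sum_comm, winProb, sum_filter, Nat.cast_sum, sum_div]
  refine sum_congr rfl fun U _ => ?_
  rw [← mul_sum, E.attendProb_eq]
  -- For a fixed attendance set exactly one `k` contributes if `c` wins, and none otherwise.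
  by_cases hw : E.IsWinner (rule v) U E.cand
  · have hc : #{i ∈ U | E.key v i = E.cand} ∈ range (E.n + 1) := by
      rw [mem_range, Nat.lt_succ_iff]
      exact (card_le_univ _).trans (by simp)
    simp only [hw, and_true, if_true]
    rw [sum_ite_eq' (range (E.n + 1)), if_pos hc, mul_one]
  · simp [hw]

end Input
end Election

/-! ### Size bounds for the input and for the generating functions. -/

open Polynomial

theorem List.getD_flatten_ofFn {α : Type*} (w : ℕ) {n : ℕ} (f : Fin n → List α)
    (hf : ∀ i, (f i).length = w) (e : α) (i : Fin n) {j : ℕ} (hj : j < w) :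
    (List.ofFn f).flatten.getD (i * w + j) e = (f i).getD j e := by
  induction n with
  | zero => exact i.elim0
  | succ n ih =>
    rw [List.ofFn_succ, List.flatten_cons]
    cases i using Fin.cases with
    | zero => rw [List.getD_append _ _ _ _ (by simpa [hf] using hj)]; simp
    | succ i =>
      rw [List.getD_append_right _ _ _ _ (by rw [hf, Fin.val_succ, add_mul]; omega), hf,
        ← ih (fun i => f i.succ) (fun i => hf _) i]
      congr 1
      rw [Fin.val_succ, add_mul]
      omega

theorem RAM.length_le_inputSize (l : List ℕ) : l.length ≤ RAM.inputSize l := by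
  induction l with
  | nil => simp [inputSize]
  | cons a l ih =>
    simp only [inputSize, List.map_cons, List.sum_cons, List.length_cons] at ih ⊢
    omega

theorem RAM.size_le_inputSize {l : List ℕ} {a : ℕ} (ha : a ∈ l) : a.size ≤ RAM.inputSize l :=
  (Nat.le_succ _).trans (List.le_sum_of_mem (List.mem_map_of_mem ha))

theorem RAM.init_mem_lt (l : List ℕ) (i : ℕ) : (RAM.init l).mem i < 2 ^ RAM.inputSize l := by
  change l.getD i 0 < _
  by_cases hi : i < l.length
  · rw [List.getD_eq_getElem _ _ hi, ← Nat.size_le]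
    exact size_le_inputSize (List.getElem_mem hi)
  · rw [List.getD_eq_default _ _ (by omega)]
    positivity

namespace RAM

theorem eval_factor_le {μ : ℕ → ℕ} {m o x i d : ℕ}
    (h₁ : μ (3 + i * (m + 2)) ≤ μ (3 + i * (m + 2) + 1)) (hd : μ (3 + i * (m + 2) + 1) ≤ d)
    (h0 : 1 ≤ d) : (factor μ m o x i).eval 1 ≤ d := by
  unfold factor
  split_ifs
  · simp
    omega
  · simpa

theorem natDegree_votes_le (μ : ℕ → ℕ) (m o x i : ℕ) : (votes μ m o x i).natDegree ≤ i := by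
  refine (natDegree_prod_le _ _).trans
    ((Finset.sum_le_card_nsmul _ _ 1 fun l _ => ?_).trans (by simp))
  unfold factor
  split_ifs
  · exact natDegree_linear_le
  · simp

/-- The degree is at most `n`, so the sum is the value at 1, where a factor equals a denominator or
1. -/
theorem sum_coeff_votes_le {μ : ℕ → ℕ} {m o x i n d : ℕ} (hi : i ≤ n)
    (h₁ : ∀ l < n, μ (3 + l * (m + 2)) ≤ μ (3 + l * (m + 2) + 1))
    (hd : ∀ l < n, μ (3 + l * (m + 2) + 1) ≤ d) (h0 : 1 ≤ d) :
    ∑ j ∈ Finset.range (n + 1), (votes μ m o x i).coeff j ≤ d ^ n := by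
  have h := eval_eq_sum_range' (p := votes μ m o x i) (n := n + 1)
    (by have := natDegree_votes_le μ m o x i; omega) 1
  simp only [one_pow, mul_one] at h
  rw [← h, votes, eval_prod]
  refine (Finset.prod_le_pow_card _ _ d fun l hl => ?_).trans ?_
  · have := Finset.mem_range.1 hl
    exact eval_factor_le (h₁ l (by omega)) (hd l (by omega)) h0
  · rw [Finset.card_range]
    exact Nat.pow_le_pow_right h0 hi

end RAM

/-! ### Reading the encoding, and the final polynomial bound. -/

namespace Election.Input

variable (E : Input)

theorem length_encode : E.encode.length = 3 + E.n * (E.m + 2) := by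
  simp [encode, List.length_flatten, List.map_ofFn, Function.comp_def]
  ring

theorem getD_encode (i : Fin E.n) {j : ℕ} (hj : j < E.m + 2) :
    E.encode.getD (3 + i * (E.m + 2) + j) 0 =
      ([E.num i, E.den i] ++ List.ofFn fun j : Fin E.m => (E.ranking i j : ℕ)).getD j 0 := by
  rw [encode, List.getD_append_right _ _ _ _ (by simp; omega),
    ← List.getD_flatten_ofFn (E.m + 2) (fun i : Fin E.n =>
      [E.num i, E.den i] ++ List.ofFn fun j : Fin E.m => (E.ranking i j : ℕ)) (by simp) 0 i hj]
  congr 1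
  simp
  omega

theorem getD_encode_num (i : Fin E.n) : E.encode.getD (3 + i * (E.m + 2)) 0 = E.num i := by
  simpa using E.getD_encode i (j := 0) (by omega)

theorem getD_encode_den (i : Fin E.n) : E.encode.getD (3 + i * (E.m + 2) + 1) 0 = E.den i := by
  simpa using E.getD_encode i (j := 1) (by omega)

theorem getD_encode_ranking (i : Fin E.n) (j : Fin E.m) :
    E.encode.getD (3 + i * (E.m + 2) + (2 + j)) 0 = E.ranking i j := by
  rw [E.getD_encode i (by omega), List.getD_append_right _ _ _ _ (by simp)]
  simp

/-- Two cells precede a ranking, so its top is at offset 2 and its bottom at `2 + (m - 1)`. -/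
theorem getD_encode_key (v : Bool) (i : Fin E.n) :
    E.encode.getD (3 + i * (E.m + 2) + RAM.offset v E.m) 0 = E.key v i := by
  rw [key, ← getD_encode_ranking]
  congr 2
  have := E.cand.pos
  cases v <;> simp [RAM.offset]
  omega

theorem votes_eq (v : Bool) (x : Fin E.m) :
    RAM.votes (RAM.init E.encode).mem E.m (RAM.offset v E.m) x E.n = E.votes v x := by
  rw [RAM.votes, votes, Finset.prod_range]
  refine Finset.prod_congr rfl fun i _ => ?_
  simp only [RAM.factor, RAM.init, getD_encode_key, getD_encode_num, getD_encode_den,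
    Fin.val_inj]

theorem prod_den_eq : ∏ l ∈ Finset.range E.n, (RAM.init E.encode).mem (3 + l * (E.m + 2) + 1) =
    ∏ i, E.den i := by
  rw [Finset.prod_range]
  exact Finset.prod_congr rfl fun i _ => E.getD_encode_den i

open RAM in
theorem computableInPolyTime_winProb (v : Bool) :
    ComputableInPolyTime encode fun E => E.winProb (rule v) := by
  -- Instruction count times `1 + 2 * V.size`, where `V.size = L ^ 3 + L + 3` for the `V` below.
  refine ⟨winProbProg v, (100 * X ^ 4 + 10) * (2 * X ^ 3 + 2 * X + 7), fun E => ?_⟩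
  set L := inputSize E.encode
  set V := 2 ^ (L ^ 3 + L + 2) with hV
  set μ := (init E.encode).mem with hμ
  have hlen : 3 + E.n * (E.m + 2) ≤ L := E.length_encode ▸ length_le_inputSize _
  have hL2 : L < 2 ^ L := Nat.lt_two_pow_self
  have hpow : ∀ {i}, i ≤ L ^ 3 + L + 2 → 2 ^ i ≤ V := Nat.pow_le_pow_right (by norm_num)
  have hBdd : (init E.encode).Bdd V := by
    refine ⟨fun r => Nat.zero_le _, fun i => ?_⟩
    exact (init_mem_lt _ _).le.trans (hpow (by omega))
  have hm : μ 0 = E.m := rfl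
  have hn : μ 1 = E.n := rfl
  have hc : μ 2 = E.cand := rfl
  have hden : (∏ i, E.den i) ≠ 0 := Finset.prod_ne_zero_iff.2 fun i _ => (E.den_pos i).ne'
  have main : WP V (100 * L ^ 4 + 1 + 1 + 1) (winProbProg v) (fun s => s.reg 1 ≠ 0 ∧
      (s.reg 0 : ℚ) / (s.reg 1 : ℚ) = E.winProb (rule v)) (init E.encode) := by
    have hV1 : 1 ≤ V := Nat.one_le_two_pow
    refine .step (.const hV1 ?_)
    refine .step (.load (v := E.n) hn ?_)
    refine .ite (fun h5 => ?_) fun h5 => ?_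
    · simp only [State.reg_setReg, if_true] at h5
      -- A voter lists all candidates, so `m + 2` is bounded by the input length; this fails for `n
      -- = 0`.
      have hn₁ : 1 * (E.m + 2) ≤ E.n * (E.m + 2) := Nat.mul_le_mul_right _ (by omega)
      have hm₁ : E.n * 2 ≤ E.n * (E.m + 2) := Nat.mul_le_mul_left _ (by omega)
      have hd : ∀ l < E.n, μ (3 + l * (E.m + 2) + 1) ≤ 2 ^ L := fun l _ => (init_mem_lt _ _).le
      have hL1 : 1 ≤ 2 ^ L := Nat.one_le_two_pow
      have hL3 : L * L * L = L ^ 3 := by ring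
      have hnL : L * E.n ≤ L * L := Nat.mul_le_mul_left _ (by omega)
      have hLL : L * L ≤ L * L * L := Nat.le_mul_of_pos_right _ (by omega)
      have hDV : (2 ^ L) ^ E.n ≤ V := by
        rw [← pow_mul]
        exact hpow (by omega)
      refine WP.mono (wp_winProbPos (D := (2 ^ L) ^ E.n) v (by simp [hμ])
        (by simp [init]) hm hn hc ?_ E.cand.pos (fun i hi x => sum_coeff_votes_le hi ?_ hd hL1)
        (Nat.one_le_pow _ _ hL1) hDV ?_ fun i hi => ?_) ?_ ?_
      · have : 2 ^ (L + 2) ≤ V := hpow (by omega)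
        rw [pow_add] at this
        omega
      · intro l hl
        have h₁ := E.getD_encode_num ⟨l, hl⟩
        have h₂ := E.getD_encode_den ⟨l, hl⟩
        exact h₁.le.trans ((E.num_le_den _).trans h₂.ge)
      -- The largest number is `(n + 1) * 2 ^ (L * n * m)`, at most `2 ^ (L + L ^ 3)`: the source of
      -- the exponent in `V`.
      · rw [← pow_mul, ← pow_mul]
        refine (Nat.mul_le_mul_right _ (show E.n + 1 ≤ 2 ^ L by omega)).trans ?_
        rw [← pow_add]
        have : L * E.n * E.m ≤ L * L * L := Nat.mul_le_mul hnL (by omega)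
        rw [mul_assoc] at this
        exact hpow (by omega)
      · refine (Finset.prod_le_pow_card _ _ (2 ^ L) fun l hl => ?_).trans ?_
        · exact hd l (by have := Finset.mem_range.1 hl; omega)
        · rw [Finset.card_range]
          exact (Nat.pow_le_pow_right hL1 hi).trans hDV
      · calc 100 * (E.m + 1) * (E.n + 1) ^ 3 ≤ 100 * L * L ^ 3 := by gcongr <;> omega
          _ = 100 * L ^ 4 := by ring
      · rintro s ⟨h0, h1⟩
        rw [hμ, E.prod_den_eq] at h1
        simp only [Finset.prod_range, hμ, votes_eq] at h0
        rw [winProb_eq, h0, h1]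
        exact ⟨hden, rfl⟩
    -- Without voters all scores are 0, so `c` wins with probability 1.
    · simp only [State.reg_setReg, if_true] at h5
      refine WP.mono (k := 1 + 1) (.step (.const hV1 (.const hV1 ?_)))
        (by have : 1 ≤ L ^ 4 := Nat.one_le_pow _ _ (by omega)
            omega) fun _ h => h
      have : IsEmpty (Fin E.n) := by
        rw [h5]
        infer_instance
      have hw : ∀ U, E.IsWinner (rule v) U E.cand := by
        intro U x
        simp [score, Finset.eq_empty_of_isEmpty U]
      have hU : ∀ U, E.attendProb U = 1 := fun U => by
        rw [attendProb, Finset.prod_of_isEmpty, Finset.prod_of_isEmpty, mul_one]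
      simp [winProb, hw, hU]
  obtain ⟨s, t, he, ht, -, h1, h2⟩ := main hBdd
  refine ⟨s, t, he, ht.trans ?_, h1, h2⟩
  rw [hV, Nat.size_pow]
  simp only [eval_mul, eval_add, eval_pow, eval_X, eval_ofNat]
  exact Nat.mul_le_mul (by omega) (by omega)

end Election.Input

theorem mainTheorem2 :
    RAM.ComputableInPolyTime Election.Input.encode
        (fun E => E.winProb Election.plurality) ∧
      RAM.ComputableInPolyTime Election.Input.encode
        (fun E => E.winProb Election.veto) :=
  ⟨Election.Input.computableInPolyTime_winProb true,
    Election.Input.computableInPolyTime_winProb false⟩
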